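/- For $k\in\mathbb N$ write $M_k(\mathbb C)$ for the complex $k\times k$ matrices and $M_k^{++}(\mathbb C)$ for the positive definite ones. A linear map $\Phi:M_n(\mathbb C)\to M_m(\mathbb C)$ is completely positive if for every $k$ and every positive semidefinite $k\times k$ block matrix $[A_{ab}]$ with blocks $A_{ab}\in M_n(\mathbb C)$, the block matrix $[\Phi(A_{ab})]$ is positive semidefinite; it is unital if $\Phi(I)=I$. Let $\Phi^\dagger:M_m(\mathbb C)\to M_n(\mathbb C)$ be the adjoint of $\Phi$ with respect to the Hilbert–Schmidt inner products $\langle A,B\rangle=\operatorname{tr}[A^*B]$. **Theorem.** For all $0\le t\le 1$, all $m,n\in\mathbb N$, all $X,Y\in M_m^{++}(\mathbb C)$, all $K\in M_m(\mathbb C)$, and all completely positive unital maps $\Phi:M_n(\mathbb C)\to M_m(\mathbb C)$ such that $\Phi^\dagger(X),\Phi^\dagger(Y)\in M_n^{++}(\mathbb C)$, both traces below are real and $$\operatorname{tr}\big[\Phi^\dagger(K^*)\,\Phi^\dagger(Y)^{t-1}\,\Phi^\dagger(K)\,\Phi^\dagger(X)^{-t}\big]\ \le\ \operatorname{tr}\big[K^*\,Y^{t-1}\,K\,X^{-t}\big].$$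 -/

import Mathlib

open scoped MatrixOrder ComplexOrder

/-- A linear map `Φ : M_n(ℂ) → M_m(ℂ)` is `k`-positive if, whenever a `k × k` block matrix with
blocks `M a b ∈ M_n(ℂ)` is positive semidefinite (as a `kn × kn` matrix), so is the block matrix
with blocks `Φ (M a b) ∈ M_m(ℂ)`.  `Matrix.comp` turns a matrix of blocks into the big matrix. -/
def IsKPositiveMap {n m : ℕ} (k : ℕ)
    (Φ : Matrix (Fin n) (Fin n) ℂ →ₗ[ℂ] Matrix (Fin m) (Fin m) ℂ) : Prop :=
  ∀ M : Matrix (Fin k) (Fin k) (Matrix (Fin n) (Fin n) ℂ),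
    (Matrix.comp (Fin k) (Fin k) (Fin n) (Fin n) ℂ M).PosSemidef →
      (Matrix.comp (Fin k) (Fin k) (Fin m) (Fin m) ℂ (M.map Φ)).PosSemidef

/-- A linear map between matrix algebras is completely positive if it is `k`-positive for
every `k`. -/
def IsCompletelyPositiveMap {n m : ℕ}
    (Φ : Matrix (Fin n) (Fin n) ℂ →ₗ[ℂ] Matrix (Fin m) (Fin m) ℂ) : Prop :=
  ∀ k : ℕ, IsKPositiveMap k Φ

/-- The Hilbert–Schmidt inner product `⟨A, B⟩ = tr[A* B]` on `M_n(ℂ)`. -/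
def hsInner {n : ℕ} (A B : Matrix (Fin n) (Fin n) ℂ) : ℂ :=
  (A.conjTranspose * B).trace

/-- The adjoint `Φ† : M_m(ℂ) → M_n(ℂ)` of a linear map `Φ : M_n(ℂ) → M_m(ℂ)` with respect to the
Hilbert–Schmidt inner products.  Its `(i, j)` entry at `X` is `⟨Φ(E_ij), X⟩`, where the `E_ij` are
the matrix units, an orthonormal basis of `M_n(ℂ)`; see `hsInner_hsAdjoint` and
`eq_hsAdjoint_of_hsInner` for the characterization as the adjoint. -/
def hsAdjoint {n m : ℕ} (Φ : Matrix (Fin n) (Fin n) ℂ →ₗ[ℂ] Matrix (Fin m) (Fin m) ℂ) :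
    Matrix (Fin m) (Fin m) ℂ →ₗ[ℂ] Matrix (Fin n) (Fin n) ℂ where
  toFun X := Matrix.of fun i j => hsInner (Φ (Matrix.single i j 1)) X
  map_add' X Y := by
    ext i j
    simp [hsInner, Matrix.mul_add]
  map_smul' c X := by
    ext i j
    simp [hsInner]

theorem hsInner_single {n : ℕ} (i j : Fin n) (B : Matrix (Fin n) (Fin n) ℂ) :
    hsInner (Matrix.single i j 1) B = B i j := by
  simp [hsInner, Matrix.conjTranspose_single, Matrix.trace_single_mul]

/-- The defining property of the adjoint: `⟨A, Φ†(X)⟩ = ⟨Φ(A), X⟩`. -/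
theorem hsInner_hsAdjoint {n m : ℕ}
    (Φ : Matrix (Fin n) (Fin n) ℂ →ₗ[ℂ] Matrix (Fin m) (Fin m) ℂ)
    (A : Matrix (Fin n) (Fin n) ℂ) (X : Matrix (Fin m) (Fin m) ℂ) :
    hsInner A (hsAdjoint Φ X) = hsInner (Φ A) X := by
  induction A using Matrix.induction_on' with
  | h_zero => simp [hsInner]
  | h_add p q hp hq =>
    simp only [hsInner, map_add, Matrix.conjTranspose_add, Matrix.add_mul, Matrix.trace_add]
      at hp hq ⊢
    rw [hp, hq]
  | h_std_basis i j x =>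
    have hx : Matrix.single i j x = x • Matrix.single i j (1 : ℂ) := by simp
    have hs : ∀ {p : ℕ} (B C : Matrix (Fin p) (Fin p) ℂ),
        hsInner (x • B) C = star x * hsInner B C := by
      intro p B C
      simp [hsInner, Matrix.conjTranspose_smul]
    rw [hx, map_smul, hs, hs, hsInner_single]
    rfl

/-- The adjoint is the only map with its defining property. -/
theorem eq_hsAdjoint_of_hsInner {n m : ℕ}
    (Φ : Matrix (Fin n) (Fin n) ℂ →ₗ[ℂ] Matrix (Fin m) (Fin m) ℂ)
    (Ψ : Matrix (Fin m) (Fin m) ℂ → Matrix (Fin n) (Fin n) ℂ)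
    (h : ∀ A X, hsInner A (Ψ X) = hsInner (Φ A) X) (X : Matrix (Fin m) (Fin m) ℂ) :
    Ψ X = hsAdjoint Φ X := by
  ext i j
  rw [← hsInner_single i j (Ψ X), h, ← hsInner_hsAdjoint, hsInner_single]

/-! For `0 < t < 1`, the kernel `a ^ (t - 1) * b ^ (-t)` is an integral over `s > 0` of resolvents
`(a + s * b)⁻¹` with nonnegative weights. In eigenbases of `Y` and `X`, each trace therefore becomes
an integral of quadratic forms of the inverse of `Z ↦ Y Z + s Z X`, and it suffices to compare these
for each `s` (`resolventForm_hsAdjoint_le`).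

Such a form is the maximum over `Z` of `2 Re tr[Z* K] - tr[Z* Y Z] - s tr[Z* Z X]`. If `Z` is the
maximiser for the `Φ†` data, test the original problem at `Φ Z`: adjointness preserves the linear
term, and Kadison–Schwarz for `Z` and `Zᴴ` shows that neither quadratic term increases. Only
unitality and `2`-positivity enter. The endpoints `t = 0, 1` follow by continuity. -/

open MeasureTheory Set in
/-- Integral representation of `a ^ (t - 1) * b ^ (-t)` by the resolvent kernels `(a + s b)⁻¹`. -/
theorem exists_measure_rpow_mul_rpow_eq_integral {t : ℝ} (ht : t ∈ Ioo (0 : ℝ) 1) :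
    ∃ μ : Measure ℝ, ∀ a b : ℝ, 0 < a → 0 < b →
      IntegrableOn (fun s => s ^ (t - 1) * (a + s * b)⁻¹) (Ioi 0) μ ∧
      a ^ (t - 1) * b ^ (-t) = ∫ s in Ioi 0, s ^ (t - 1) * (a + s * b)⁻¹ ∂μ := by
  obtain ⟨μ, hμ⟩ := Real.exists_measure_rpow_eq_integral_rpowIntegrand₀₁ ht
  refine ⟨μ, fun a b ha hb => ?_⟩
  -- The kernel is homogeneous: it equals `(a / b) ^ t * a⁻¹`, so the one-variable formula at `a /
  -- b` suffices.
  obtain ⟨h1, h2⟩ := hμ (a / b) (div_pos ha hb).le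
  have hEq : EqOn (fun s => Real.rpowIntegrand₀₁ t s (a / b) * a⁻¹)
      (fun s => s ^ (t - 1) * (a + s * b)⁻¹) (Ioi 0) := by
    intro s hs
    have hs' : 0 < s := hs
    have : 0 < a + s * b := by positivity
    have : 0 < s + a / b := by positivity
    simp only [Real.rpowIntegrand₀₁_eq_pow_div ht hs'.le (div_pos ha hb).le]
    field_simp
    ring
  refine ⟨(integrableOn_congr_fun hEq measurableSet_Ioi).1 (h1.mul_const _), ?_⟩
  rw [← setIntegral_congr_fun measurableSet_Ioi hEq, integral_mul_const, ← h2,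
    Real.div_rpow ha.le hb.le, Real.rpow_sub ha, Real.rpow_one, Real.rpow_neg hb.le]
  field_simp

/-! ### Eigenbasis expansions and the variational formula -/

namespace Matrix

/-- The trace form of two diagonalised matrices is a weighted sum of squared coefficients. -/
theorem trace_conjTranspose_mul_diagonalised {p : ℕ} (K U V : Matrix (Fin p) (Fin p) ℂ)
    (a b : Fin p → ℝ) :
    (Kᴴ * (V * diagonal (fun i => (a i : ℂ)) * Vᴴ) * K *
      (U * diagonal (fun j => (b j : ℂ)) * Uᴴ)).trace =
      ((∑ i, ∑ j, a i * b j * Complex.normSq ((Vᴴ * K * U) i j) : ℝ) : ℂ) := by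
  have h : (Kᴴ * (V * diagonal (fun i => (a i : ℂ)) * Vᴴ) * K *
      (U * diagonal (fun j => (b j : ℂ)) * Uᴴ)).trace =
      ((diagonal (fun i => (a i : ℂ)) * (Vᴴ * K * U)) *
        (diagonal (fun j => (b j : ℂ)) * (Vᴴ * K * U)ᴴ)).trace := by
    simp only [conjTranspose_mul, conjTranspose_conjTranspose, Matrix.mul_assoc]
    rw [← Matrix.mul_assoc Kᴴ V, trace_mul_comm]
    simp only [Matrix.mul_assoc]
  rw [h, trace]
  push_cast
  refine Finset.sum_congr rfl fun i _ => ?_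
  rw [diag_apply, mul_apply]
  refine Finset.sum_congr rfl fun j _ => ?_
  rw [diagonal_mul, diagonal_mul, conjTranspose_apply, Complex.normSq_eq_conj_mul_self]
  simp only [RCLike.star_def]
  ring

section Eigen

variable {p : ℕ} {X Y : Matrix (Fin p) (Fin p) ℂ}

/-- The coefficients of `K` in the eigenbases of `Y` (rows) and `X` (columns). -/
noncomputable def eigenCoeff (hY : Y.IsHermitian) (hX : X.IsHermitian)
    (K : Matrix (Fin p) (Fin p) ℂ) : Matrix (Fin p) (Fin p) ℂ :=
  (hY.eigenvectorUnitary : Matrix (Fin p) (Fin p) ℂ)ᴴ * K * hX.eigenvectorUnitary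

theorem IsHermitian.eigenvectorUnitary_mul_conjTranspose (hX : X.IsHermitian) :
    (hX.eigenvectorUnitary : Matrix (Fin p) (Fin p) ℂ) *
      (hX.eigenvectorUnitary : Matrix (Fin p) (Fin p) ℂ)ᴴ = 1 :=
  Unitary.mul_star_self_of_mem hX.eigenvectorUnitary.2

theorem IsHermitian.conjTranspose_mul_eigenvectorUnitary (hX : X.IsHermitian) :
    (hX.eigenvectorUnitary : Matrix (Fin p) (Fin p) ℂ)ᴴ *
      (hX.eigenvectorUnitary : Matrix (Fin p) (Fin p) ℂ) = 1 :=
  Unitary.star_mul_self_of_mem hX.eigenvectorUnitary.2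

theorem eigenCoeff_surjective (hY : Y.IsHermitian) (hX : X.IsHermitian) :
    Function.Surjective (eigenCoeff hY hX) := by
  intro W
  refine ⟨hY.eigenvectorUnitary * W * (hX.eigenvectorUnitary : Matrix (Fin p) (Fin p) ℂ)ᴴ, ?_⟩
  calc _ = ((hY.eigenvectorUnitary : Matrix (Fin p) (Fin p) ℂ)ᴴ * hY.eigenvectorUnitary) * W *
        ((hX.eigenvectorUnitary : Matrix (Fin p) (Fin p) ℂ)ᴴ * hX.eigenvectorUnitary) := by
        simp only [eigenCoeff, Matrix.mul_assoc]
    _ = W := by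
        rw [hY.conjTranspose_mul_eigenvectorUnitary, hX.conjTranspose_mul_eigenvectorUnitary,
          Matrix.one_mul, Matrix.mul_one]

theorem IsHermitian.cfc_eq_diagonalised (hX : X.IsHermitian) (f : ℝ → ℝ) :
    cfc f X = hX.eigenvectorUnitary * diagonal (fun i => ((f (hX.eigenvalues i) : ℝ) : ℂ)) *
      (hX.eigenvectorUnitary : Matrix (Fin p) (Fin p) ℂ)ᴴ := by
  rw [hX.cfc_eq, IsHermitian.cfc, Unitary.conjStarAlgAut_apply]
  rfl

theorem trace_cfc_mul_cfc (hY : Y.IsHermitian) (hX : X.IsHermitian) (f g : ℝ → ℝ)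
    (K : Matrix (Fin p) (Fin p) ℂ) :
    (Kᴴ * cfc f Y * K * cfc g X).trace =
      ((∑ i, ∑ j, f (hY.eigenvalues i) * g (hX.eigenvalues j) *
        Complex.normSq (eigenCoeff hY hX K i j) : ℝ) : ℂ) := by
  rw [hY.cfc_eq_diagonalised, hX.cfc_eq_diagonalised, trace_conjTranspose_mul_diagonalised]
  rfl

theorem trace_rpow_mul_rpow (hY : Y.PosDef) (hX : X.PosDef) (r q : ℝ)
    (K : Matrix (Fin p) (Fin p) ℂ) :
    (Kᴴ * Y ^ r * K * X ^ q).trace =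
      ((∑ i, ∑ j, hY.1.eigenvalues i ^ r * hX.1.eigenvalues j ^ q *
        Complex.normSq (eigenCoeff hY.1 hX.1 K i j) : ℝ) : ℂ) := by
  rw [CFC.rpow_eq_cfc_real (a := Y) hY.posSemidef.nonneg,
    CFC.rpow_eq_cfc_real (a := X) hX.posSemidef.nonneg, trace_cfc_mul_cfc hY.1 hX.1]

/-- The trace does not involve `X`; expanding in its eigenbasis anyway lets all terms of
`resolventFunctional` share the same coefficients. -/
theorem trace_conjTranspose_mul_mul (hY : Y.IsHermitian) (hX : X.IsHermitian)
    (Z : Matrix (Fin p) (Fin p) ℂ) :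
    (Zᴴ * Y * Z).trace =
      ((∑ i, ∑ j, hY.eigenvalues i * Complex.normSq (eigenCoeff hY hX Z i j) : ℝ) : ℂ) := by
  have h := trace_cfc_mul_cfc hY hX id (fun _ => 1) Z
  rw [cfc_id ℝ Y hY.isSelfAdjoint, cfc_const_one ℝ X hX.isSelfAdjoint, Matrix.mul_one] at h
  simpa using h

theorem trace_conjTranspose_mul_self_mul (hY : Y.IsHermitian) (hX : X.IsHermitian)
    (Z : Matrix (Fin p) (Fin p) ℂ) :
    (Zᴴ * Z * X).trace =
      ((∑ i, ∑ j, hX.eigenvalues j * Complex.normSq (eigenCoeff hY hX Z i j) : ℝ) : ℂ) := by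
  have h := trace_cfc_mul_cfc hY hX (fun _ => 1) id Z
  rw [cfc_id ℝ X hX.isSelfAdjoint, cfc_const_one ℝ Y hY.isSelfAdjoint, Matrix.mul_one] at h
  simpa using h

theorem trace_conjTranspose_mul_eigenCoeff (hY : Y.IsHermitian) (hX : X.IsHermitian)
    (Z K : Matrix (Fin p) (Fin p) ℂ) :
    (Zᴴ * K).trace =
      ∑ i, ∑ j, star (eigenCoeff hY hX Z i j) * eigenCoeff hY hX K i j := by
  have h : ((eigenCoeff hY hX Z)ᴴ * eigenCoeff hY hX K).trace = (Zᴴ * K).trace := by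
    simp only [eigenCoeff, conjTranspose_mul, conjTranspose_conjTranspose, Matrix.mul_assoc]
    rw [trace_mul_comm]
    simp only [Matrix.mul_assoc]
    rw [hX.eigenvectorUnitary_mul_conjTranspose, Matrix.mul_one,
      ← Matrix.mul_assoc (hY.eigenvectorUnitary : Matrix (Fin p) (Fin p) ℂ),
      hY.eigenvectorUnitary_mul_conjTranspose, Matrix.one_mul]
  rw [← h, trace, Finset.sum_comm]
  simp only [diag_apply, mul_apply, conjTranspose_apply]

/-- The quadratic form of the inverse of `K ↦ Y K + s K X`, in eigenbases of `Y` and `X`. -/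
noncomputable def resolventForm (s : ℝ) (hY : Y.IsHermitian) (hX : X.IsHermitian)
    (K : Matrix (Fin p) (Fin p) ℂ) : ℝ :=
  ∑ i, ∑ j, (hY.eigenvalues i + s * hX.eigenvalues j)⁻¹ *
    Complex.normSq (eigenCoeff hY hX K i j)

/-- The concave functional whose maximum over `Z` is the resolvent form of `K`. -/
noncomputable def resolventFunctional (s : ℝ) (Y X K Z : Matrix (Fin p) (Fin p) ℂ) : ℝ :=
  2 * (Zᴴ * K).trace.re - (Zᴴ * Y * Z).trace.re - s * (Zᴴ * Z * X).trace.re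

theorem resolventFunctional_eq_sum (s : ℝ) (hY : Y.IsHermitian) (hX : X.IsHermitian)
    (K Z : Matrix (Fin p) (Fin p) ℂ) :
    resolventFunctional s Y X K Z = ∑ i, ∑ j,
      (2 * (star (eigenCoeff hY hX Z i j) * eigenCoeff hY hX K i j).re -
        (hY.eigenvalues i + s * hX.eigenvalues j) *
          Complex.normSq (eigenCoeff hY hX Z i j)) := by
  rw [resolventFunctional, trace_conjTranspose_mul_mul hY hX,
    trace_conjTranspose_mul_self_mul hY hX, trace_conjTranspose_mul_eigenCoeff hY hX,
    Complex.ofReal_re, Complex.ofReal_re]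
  simp only [Complex.re_sum, Finset.mul_sum, ← Finset.sum_sub_distrib]
  refine Finset.sum_congr rfl fun i _ => Finset.sum_congr rfl fun j _ => ?_
  ring

/-- Complete the square in each coefficient of `Z` separately. -/
theorem resolventFunctional_le (hY : Y.PosDef) (hX : X.PosDef) {s : ℝ} (hs : 0 < s)
    (K Z : Matrix (Fin p) (Fin p) ℂ) :
    resolventFunctional s Y X K Z ≤ resolventForm s hY.1 hX.1 K := by
  rw [resolventFunctional_eq_sum s hY.1 hX.1, resolventForm]
  refine Finset.sum_le_sum fun i _ => Finset.sum_le_sum fun j _ => ?_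
  have hc : 0 < hY.1.eigenvalues i + s * hX.1.eigenvalues j :=
    add_pos (hY.eigenvalues_pos i) (mul_pos hs (hX.eigenvalues_pos j))
  generalize hY.1.eigenvalues i + s * hX.1.eigenvalues j = c at hc
  generalize eigenCoeff hY.1 hX.1 Z i j = z
  generalize eigenCoeff hY.1 hX.1 K i j = k
  have h : c⁻¹ * Complex.normSq k - (2 * (star z * k).re - c * Complex.normSq z) =
      c⁻¹ * Complex.normSq (k - c * z) := by
    simp [Complex.normSq_apply]
    field_simp
    ring
  have := mul_nonneg (inv_nonneg.2 hc.le) (Complex.normSq_nonneg (k - c * z))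
  linarith

theorem exists_resolventFunctional_eq (hY : Y.PosDef) (hX : X.PosDef) {s : ℝ} (hs : 0 < s)
    (K : Matrix (Fin p) (Fin p) ℂ) :
    ∃ Z, resolventFunctional s Y X K Z = resolventForm s hY.1 hX.1 K := by
  -- The square vanishes at `z = c⁻¹ * k` in every coefficient, i.e. where `Y Z + s Z X = K`.
  obtain ⟨Z, hZ⟩ := eigenCoeff_surjective hY.1 hX.1 (of fun i j =>
    ((hY.1.eigenvalues i + s * hX.1.eigenvalues j : ℝ) : ℂ)⁻¹ * eigenCoeff hY.1 hX.1 K i j)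
  refine ⟨Z, ?_⟩
  rw [resolventFunctional_eq_sum s hY.1 hX.1, resolventForm, hZ]
  refine Finset.sum_congr rfl fun i _ => Finset.sum_congr rfl fun j _ => ?_
  have hc : 0 < hY.1.eigenvalues i + s * hX.1.eigenvalues j :=
    add_pos (hY.eigenvalues_pos i) (mul_pos hs (hX.eigenvalues_pos j))
  rw [of_apply]
  generalize hY.1.eigenvalues i + s * hX.1.eigenvalues j = c at hc
  generalize eigenCoeff hY.1 hX.1 K i j = k
  rw [← Complex.ofReal_inv, map_mul, Complex.normSq_ofReal]
  simp [Complex.normSq_apply]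
  field_simp
  ring

end Eigen

end Matrix

/-! ### Positive maps and monotonicity of the resolvent form -/

namespace Matrix

theorem PosSemidef.re_trace_mul_nonneg {p : ℕ} {A B : Matrix (Fin p) (Fin p) ℂ}
    (hA : A.PosSemidef) (hB : B.PosSemidef) : 0 ≤ (A * B).trace.re := by
  obtain ⟨C, rfl⟩ := CStarAlgebra.nonneg_iff_eq_star_mul_self.mp hB.nonneg
  rw [← Matrix.mul_assoc, trace_mul_comm, ← Matrix.mul_assoc]
  exact (Complex.le_def.1 (hA.mul_mul_conjTranspose_same C).trace_nonneg).1

end Matrix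

section Positive

open Matrix

variable {n m : ℕ} {Φ : Matrix (Fin n) (Fin n) ℂ →ₗ[ℂ] Matrix (Fin m) (Fin m) ℂ}

theorem IsKPositiveMap.posSemidef_blocks (hΦ : IsKPositiveMap 2 Φ) (Z : Matrix (Fin n) (Fin n) ℂ) :
    (comp (Fin 2) (Fin 2) (Fin m) (Fin m) ℂ
      !![Φ (Z * Zᴴ), Φ Z; Φ Zᴴ, Φ 1]).PosSemidef := by
  have h := hΦ !![Z * Zᴴ, Z; Zᴴ, 1] ?_
  · convert h using 2
    ext i j : 2
    fin_cases i <;> fin_cases j <;> rfl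
  -- The block matrix is `B Bᴴ` for the block column `B = (Z, 1)`.
  · let B : Matrix (Fin 2 × Fin n) (Fin n) ℂ := of fun x k => ![Z, 1] x.1 x.2 k
    convert posSemidef_self_mul_conjTranspose B
    ext ⟨i, a⟩ ⟨j, b⟩
    fin_cases i <;> fin_cases j <;> simp [B, mul_apply, one_apply, apply_ite]

theorem IsKPositiveMap.map_conjTranspose (hΦ : IsKPositiveMap 2 Φ)
    (Z : Matrix (Fin n) (Fin n) ℂ) : Φ Zᴴ = (Φ Z)ᴴ := by
  ext a b
  exact ((hΦ.posSemidef_blocks Z).1.apply (1, a) (0, b)).symm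

/-- The Kadison–Schwarz inequality for unital `2`-positive maps. -/
theorem IsKPositiveMap.schwarz (hΦ : IsKPositiveMap 2 Φ) (hΦ1 : Φ 1 = 1)
    (Z : Matrix (Fin n) (Fin n) ℂ) : (Φ (Z * Zᴴ) - Φ Z * (Φ Z)ᴴ).PosSemidef := by
  -- Since `Φ 1 = 1`, compressing by this block column yields the Schur complement of the lower
  -- right block.
  let B : Matrix (Fin 2 × Fin m) (Fin m) ℂ := of fun x k => ![1, -(Φ Z)ᴴ] x.1 x.2 k
  convert (hΦ.posSemidef_blocks Z).conjTranspose_mul_mul_same B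
  have h : Bᴴ * comp (Fin 2) (Fin 2) (Fin m) (Fin m) ℂ !![Φ (Z * Zᴴ), Φ Z; Φ Zᴴ, Φ 1] * B =
      1 * Φ (Z * Zᴴ) * 1 + -(Φ Z) * Φ Zᴴ * 1 +
        (1 * Φ Z * -(Φ Z)ᴴ + -(Φ Z) * Φ 1 * -(Φ Z)ᴴ) := by
    ext a b
    simp [B, mul_apply, Fintype.sum_prod_type, Finset.sum_add_distrib, add_mul, one_apply, apply_ite]
    ring
  rw [h, hΦ.map_conjTranspose, hΦ1]
  simp [sub_eq_add_neg]

theorem hsAdjoint_conjTranspose (hΦ : IsKPositiveMap 2 Φ) (K : Matrix (Fin m) (Fin m) ℂ) :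
    hsAdjoint Φ Kᴴ = (hsAdjoint Φ K)ᴴ := by
  -- `X ↦ (Φ†(Xᴴ))ᴴ` also satisfies the adjoint identity, because `Φ` commutes with `ᴴ`.
  refine (eq_hsAdjoint_of_hsInner Φ (fun X => (hsAdjoint Φ Xᴴ)ᴴ) (fun A X => ?_) Kᴴ).symm.trans
    (by simp)
  have h : ∀ {p : ℕ} (S T : Matrix (Fin p) (Fin p) ℂ), hsInner S T = star (hsInner Sᴴ Tᴴ) := by
    intro p S T
    rw [hsInner, hsInner, ← trace_conjTranspose, conjTranspose_mul, conjTranspose_conjTranspose,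
      conjTranspose_conjTranspose, trace_mul_comm]
  rw [h, conjTranspose_conjTranspose, hsInner_hsAdjoint, hΦ.map_conjTranspose, ← h]

theorem trace_conjTranspose_mul_hsAdjoint (Z : Matrix (Fin n) (Fin n) ℂ)
    (K : Matrix (Fin m) (Fin m) ℂ) :
    (Zᴴ * hsAdjoint Φ K).trace = ((Φ Z)ᴴ * K).trace :=
  hsInner_hsAdjoint Φ Z K

theorem re_trace_mul_hsAdjoint_ge (hΦ : IsKPositiveMap 2 Φ) (hΦ1 : Φ 1 = 1)
    (Z : Matrix (Fin n) (Fin n) ℂ) {Y : Matrix (Fin m) (Fin m) ℂ} (hY : Y.PosSemidef) :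
    (Φ Z * (Φ Z)ᴴ * Y).trace.re ≤ (Z * Zᴴ * hsAdjoint Φ Y).trace.re := by
  have h := (hΦ.schwarz hΦ1 Z).re_trace_mul_nonneg hY
  have h2 := trace_conjTranspose_mul_hsAdjoint (Φ := Φ) (Z * Zᴴ) Y
  rw [← hΦ.map_conjTranspose] at h2
  simp only [conjTranspose_mul, conjTranspose_conjTranspose] at h2
  rw [h2]
  rw [Matrix.sub_mul, trace_sub, Complex.sub_re] at h
  linarith

theorem resolventFunctional_hsAdjoint_le (hΦ : IsKPositiveMap 2 Φ) (hΦ1 : Φ 1 = 1) {s : ℝ}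
    (hs : 0 ≤ s) {X Y : Matrix (Fin m) (Fin m) ℂ} (hX : X.PosSemidef) (hY : Y.PosSemidef)
    (K : Matrix (Fin m) (Fin m) ℂ) (Z : Matrix (Fin n) (Fin n) ℂ) :
    resolventFunctional s (hsAdjoint Φ Y) (hsAdjoint Φ X) (hsAdjoint Φ K) Z ≤
      resolventFunctional s Y X K (Φ Z) := by
  have h1 := re_trace_mul_hsAdjoint_ge hΦ hΦ1 Z hY
  have h2 := mul_le_mul_of_nonneg_left (re_trace_mul_hsAdjoint_ge hΦ hΦ1 Zᴴ hX) hs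
  rw [hΦ.map_conjTranspose, conjTranspose_conjTranspose, conjTranspose_conjTranspose] at h2
  rw [resolventFunctional, resolventFunctional, trace_conjTranspose_mul_hsAdjoint,
    trace_mul_cycle Zᴴ, trace_mul_cycle (Φ Z)ᴴ Y]
  linarith

theorem resolventForm_hsAdjoint_le (hΦ : IsKPositiveMap 2 Φ) (hΦ1 : Φ 1 = 1) {s : ℝ}
    (hs : 0 < s) {X Y : Matrix (Fin m) (Fin m) ℂ} (hX : X.PosDef) (hY : Y.PosDef)
    (hΦX : (hsAdjoint Φ X).PosDef) (hΦY : (hsAdjoint Φ Y).PosDef)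
    (K : Matrix (Fin m) (Fin m) ℂ) :
    resolventForm s hΦY.1 hΦX.1 (hsAdjoint Φ K) ≤ resolventForm s hY.1 hX.1 K := by
  obtain ⟨Z, hZ⟩ := exists_resolventFunctional_eq hΦY hΦX hs (hsAdjoint Φ K)
  rw [← hZ]
  exact (resolventFunctional_hsAdjoint_le hΦ hΦ1 hs.le hX.posSemidef hY.posSemidef K Z).trans
    (resolventFunctional_le hY hX hs K _)

end Positive

/-! ### Integration over `s` and the endpoints -/

namespace Matrix

open MeasureTheory Set

variable {p : ℕ} {X Y : Matrix (Fin p) (Fin p) ℂ}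

/-- The eigenbasis expansion of `tr[K* Y ^ (t - 1) K X ^ (-t)]`. -/
noncomputable def rpowForm (t : ℝ) (hY : Y.IsHermitian) (hX : X.IsHermitian)
    (K : Matrix (Fin p) (Fin p) ℂ) : ℝ :=
  ∑ i, ∑ j, hY.eigenvalues i ^ (t - 1) * hX.eigenvalues j ^ (-t) *
    Complex.normSq (eigenCoeff hY hX K i j)

theorem continuous_rpowForm (hY : Y.PosDef) (hX : X.PosDef) (K : Matrix (Fin p) (Fin p) ℂ) :
    Continuous fun t => rpowForm t hY.1 hX.1 K := by
  refine continuous_finsetSum _ fun i _ => continuous_finsetSum _ fun j _ => ?_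
  refine Continuous.mul (Continuous.mul ?_ ?_) continuous_const
  · exact continuous_const.rpow (by fun_prop) fun _ => Or.inl (hY.eigenvalues_pos i).ne'
  · exact continuous_const.rpow (by fun_prop) fun _ => Or.inl (hX.eigenvalues_pos j).ne'

/-- The measure is chosen before the size `p` and the matrices, so the same one serves both sides of
the inequality. -/
theorem exists_measure_rpowForm_eq_integral {t : ℝ} (ht : t ∈ Ioo (0 : ℝ) 1) :
    ∃ μ : Measure ℝ, ∀ (p : ℕ) (X Y : Matrix (Fin p) (Fin p) ℂ) (hY : Y.PosDef) (hX : X.PosDef)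
      (K : Matrix (Fin p) (Fin p) ℂ),
      IntegrableOn (fun s => s ^ (t - 1) * resolventForm s hY.1 hX.1 K) (Ioi 0) μ ∧
      rpowForm t hY.1 hX.1 K =
        ∫ s in Ioi 0, s ^ (t - 1) * resolventForm s hY.1 hX.1 K ∂μ := by
  obtain ⟨μ, hμ⟩ := exists_measure_rpow_mul_rpow_eq_integral ht
  refine ⟨μ, fun p X Y hY hX K => ?_⟩
  have hs (s : ℝ) : s ^ (t - 1) * resolventForm s hY.1 hX.1 K =
      ∑ i, ∑ j, s ^ (t - 1) * (hY.1.eigenvalues i + s * hX.1.eigenvalues j)⁻¹ *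
        Complex.normSq (eigenCoeff hY.1 hX.1 K i j) := by
    simp only [resolventForm, Finset.mul_sum, mul_assoc]
  have hint (i j) := ((hμ _ _ (hY.eigenvalues_pos i) (hX.eigenvalues_pos j)).1.mul_const
    (Complex.normSq (eigenCoeff hY.1 hX.1 K i j)))
  simp only [hs]
  refine ⟨integrable_finsetSum _ fun i _ => integrable_finsetSum _ fun j _ => hint i j, ?_⟩
  rw [integral_finsetSum _ fun i _ => integrable_finsetSum _ fun j _ => hint i j, rpowForm]
  refine Finset.sum_congr rfl fun i _ => ?_
  rw [integral_finsetSum _ fun j _ => hint i j]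
  refine Finset.sum_congr rfl fun j _ => ?_
  rw [integral_mul_const, (hμ _ _ (hY.eigenvalues_pos i) (hX.eigenvalues_pos j)).2]

theorem rpowForm_hsAdjoint_le {n m : ℕ}
    {Φ : Matrix (Fin n) (Fin n) ℂ →ₗ[ℂ] Matrix (Fin m) (Fin m) ℂ}
    (hΦ : IsKPositiveMap 2 Φ) (hΦ1 : Φ 1 = 1) {t : ℝ} (ht : t ∈ Icc (0 : ℝ) 1)
    {X Y : Matrix (Fin m) (Fin m) ℂ} (hX : X.PosDef) (hY : Y.PosDef)
    (hΦX : (hsAdjoint Φ X).PosDef) (hΦY : (hsAdjoint Φ Y).PosDef)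
    (K : Matrix (Fin m) (Fin m) ℂ) :
    rpowForm t hΦY.1 hΦX.1 (hsAdjoint Φ K) ≤ rpowForm t hY.1 hX.1 K := by
  -- The set of `t` where the inequality holds is closed, so the open interval suffices.
  rw [← closure_Ioo zero_ne_one] at ht
  refine closure_minimal (s := Ioo (0 : ℝ) 1) (fun r hr => ?_)
    (isClosed_le (continuous_rpowForm hΦY hΦX _) (continuous_rpowForm hY hX K)) ht
  obtain ⟨μ, hμ⟩ := exists_measure_rpowForm_eq_integral hr
  obtain ⟨h1, h2⟩ := hμ m X Y hY hX K
  obtain ⟨h3, h4⟩ := hμ n _ _ hΦY hΦX (hsAdjoint Φ K)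
  rw [mem_ofPred_eq, h2, h4]
  refine setIntegral_mono_on h3 h1 measurableSet_Ioi fun s hs => ?_
  exact mul_le_mul_of_nonneg_left (resolventForm_hsAdjoint_le hΦ hΦ1 hs hX hY hΦX hΦY K)
    (Real.rpow_nonneg (le_of_lt hs) _)

end Matrix

/-- Powers such as `Y ^ (t - 1)` are real powers of positive definite matrices in the sense of the
continuous functional calculus.  Both traces are real, and the inequality is between them. -/
theorem theorem2p6 (t : ℝ) (ht0 : 0 ≤ t) (ht1 : t ≤ 1) (m n : ℕ)
    (X Y : Matrix (Fin m) (Fin m) ℂ) (hX : X.PosDef) (hY : Y.PosDef)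
    (K : Matrix (Fin m) (Fin m) ℂ)
    (Φ : Matrix (Fin n) (Fin n) ℂ →ₗ[ℂ] Matrix (Fin m) (Fin m) ℂ)
    (hΦ : IsCompletelyPositiveMap Φ) (hΦ1 : Φ 1 = 1)
    (hΦX : (hsAdjoint Φ X).PosDef) (hΦY : (hsAdjoint Φ Y).PosDef) :
    (hsAdjoint Φ K.conjTranspose * (hsAdjoint Φ Y) ^ (t - 1) * hsAdjoint Φ K *
        (hsAdjoint Φ X) ^ (-t)).trace.im = 0 ∧
    (K.conjTranspose * Y ^ (t - 1) * K * X ^ (-t)).trace.im = 0 ∧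
    (hsAdjoint Φ K.conjTranspose * (hsAdjoint Φ Y) ^ (t - 1) * hsAdjoint Φ K *
        (hsAdjoint Φ X) ^ (-t)).trace.re ≤
      (K.conjTranspose * Y ^ (t - 1) * K * X ^ (-t)).trace.re := by
  rw [hsAdjoint_conjTranspose (hΦ 2), Matrix.trace_rpow_mul_rpow hΦY hΦX,
    Matrix.trace_rpow_mul_rpow hY hX]
  exact ⟨Complex.ofReal_im _, Complex.ofReal_im _,
    Matrix.rpowForm_hsAdjoint_le (hΦ 2) hΦ1 ⟨ht0, ht1⟩ hX hY hΦX hΦY K⟩
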